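/- **Stability estimate for IBVP-1.** Let $\ell,T,\alpha,C_g>0$ and let $\rho,\mu\in L^\infty(0,\ell)$, $r,\kappa\in H^2(0,\ell)$ satisfy $$0<\rho_0\le\rho(x)\le\rho_1,\qquad 0\le\mu_0\le\mu(x)\le\mu_1,\qquad 0<r_0\le r(x)\le r_1,\qquad \kappa_0\le\kappa(x)\le\kappa_1,$$ where $$\kappa_0:=\frac{\sqrt2\,T^2\ell^6e^T(1+T)}{9\,r_0\,\alpha}.$$ Put $\mathcal V=\{v\in H^2(0,\ell): v(0)=v_x(0)=0\}$ and $\mathcal G_1=\{g\in H^1(0,T): g(0)=0,\ \|g\|_{H^1(0,T)}\le C_g\}$. For $g\in\mathcal G_1$ let $u=u(\cdot,\cdot\,;g)$ be the weak solution of the beam problem with shear force $g$ at $x=\ell$, that is, $u,u_t\in L^2(0,T;\mathcal V)$, $u_{tt}\in L^2(0,T;L^2(0,\ell))$, $u(0)=0$, $u_t(0)=0$ and, for almost every $t\in(0,T)$ and all $v\in\mathcal V$, $$\int_0^\ell\big(\rho\,u_{tt}(t)\,v+\mu\,u_t(t)\,v+r\,u_{xx}(t)\,v_{xx}+\kappa\,u_{xxt}(t)\,v_{xx}\big)\,dx=g(t)\,v(\ell).$$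 For $\nu\in H^1(0,T)$ let $$\mathcal J_{1\alpha}(g)=\tfrac12\int_0^T\big(u(\ell,t;g)-\nu(t)\big)^2dt+\tfrac\alpha2\int_0^T g'(t)^2\,dt .$$ Let $g_\alpha,\widehat g_\alpha\in\mathcal G_1$ be the minimizers of $\mathcal J_{1\alpha}$ over $\mathcal G_1$ for data $\nu,\widehat\nu\in H^1(0,T)$ respectively, and let $\xi(t)=u(\ell,t;g_\alpha)-\nu(t)$, $\widehat\xi(t)=u(\ell,t;\widehat g_\alpha)-\widehat\nu(t)$ be the residuals. Assume that the residuals are consistent in the sense that $\xi(t_0)=\widehat\xi(t_0)$ for at least one $t_0\in[0,T]$ (for instance $\xi(T)=\widehat\xi(T)=0$, or $\nu(0)=\widehat\nu(0)$). Then $$\|\widehat g_\alpha-g_\alpha\|^2_{L^2(0,T)}\le C_{ST}\,\|\widehat\nu'-\nu'\|^2_{L^2(0,T)},\qquad C_{ST}=\frac{9\,r_0\,\kappa_0\,T^2}{\ell^6e^T(1+T)} .$$ In particular $\mu\equiv0$ is allowed. -/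

import Mathlib

open Set MeasureTheory

noncomputable section

namespace Beam

/-! ### Sobolev functions of one variable -/

/-- `f ∈ H¹(0,L)`, for the continuous representative `f` on `[0,L]`: `f` is absolutely continuous
on `[0,L]` and its (almost everywhere defined) derivative is square integrable. -/
def MemH1 (L : ℝ) (f : ℝ → ℝ) : Prop :=
  AbsolutelyContinuousOnInterval f 0 L ∧ MemLp (deriv f) 2 (volume.restrict (Ioo 0 L))

/-- `f ∈ H²(0,L)` with first derivative `p`, both given by their continuous representatives on
`[0,L]`; the second derivative is `deriv p ∈ L²(0,L)`. -/
def HasH2Deriv (L : ℝ) (f p : ℝ → ℝ) : Prop :=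
  MemH1 L f ∧ MemH1 L p ∧ deriv f =ᵐ[volume.restrict (Ioo 0 L)] p

/-- `f ∈ H²(0,L)`, for the continuous representative `f` on `[0,L]`. -/
def MemH2 (L : ℝ) (f : ℝ → ℝ) : Prop := ∃ p, HasH2Deriv L f p

/-- The norm of `H¹(0,L)`. -/
def normH1 (L : ℝ) (f : ℝ → ℝ) : ℝ :=
  Real.sqrt ((∫ t in (0 : ℝ)..L, f t ^ 2) + ∫ t in (0 : ℝ)..L, deriv f t ^ 2)

/-! ### The energy space of the beam -/

/-- `L²(0,ℓ)`. -/
abbrev L2 (ℓ : ℝ) := Lp ℝ 2 (volume.restrict (Ioo 0 ℓ))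

/-- Triples in `L²(0,ℓ)³` with the Hilbert norm `(‖v‖² + ‖p‖² + ‖w‖²)^(1/2)`. A function
`v ∈ H²(0,ℓ)` is identified with the triple `(v, v_x, v_xx)`, isometrically for the standard norm
of `H²(0,ℓ)`. -/
abbrev Jet (ℓ : ℝ) := PiLp 2 (fun _ : Fin 3 => L2 ℓ)

/-- The triple `v` is `(f, f_x, f_xx)` for a function `f` of the space
`𝒱₁²(0,ℓ) = {f ∈ H²(0,ℓ) : f(0) = f_x(0) = 0}`. -/
def MemV (ℓ : ℝ) (v : Jet ℓ) : Prop :=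
  ∃ f p : ℝ → ℝ, HasH2Deriv ℓ f p ∧ f 0 = 0 ∧ p 0 = 0 ∧
    v 0 =ᵐ[volume.restrict (Ioo 0 ℓ)] f ∧
    v 1 =ᵐ[volume.restrict (Ioo 0 ℓ)] p ∧
    v 2 =ᵐ[volume.restrict (Ioo 0 ℓ)] deriv p

/-- The value at `x = ℓ` of (the continuous representative of) the function described by
`v = (f, f_x, f_xx)` in `𝒱₁²(0,ℓ)`, that is `∫₀^ℓ f_x dx = f(ℓ)`; see `tip_eq`. -/
def tip (ℓ : ℝ) (v : Jet ℓ) : ℝ := ∫ x in (0 : ℝ)..ℓ, v 1 x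

theorem tip_eq {ℓ : ℝ} (hℓ : 0 < ℓ) {v : Jet ℓ} {f p : ℝ → ℝ} (hf : HasH2Deriv ℓ f p)
    (h0 : f 0 = 0) (hv : v 1 =ᵐ[volume.restrict (Ioo 0 ℓ)] p) : tip ℓ v = f ℓ := by
  have h1 := hf.1.1.integral_deriv_eq_sub
  have h2 : v 1 =ᵐ[volume.restrict (Ioo 0 ℓ)] deriv f := hv.trans hf.2.2.symm
  rw [h0, sub_zero] at h1
  rw [tip, ← h1, intervalIntegral.integral_of_le hℓ.le, intervalIntegral.integral_of_le hℓ.le,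
    integral_Ioc_eq_integral_Ioo, integral_Ioc_eq_integral_Ioo]
  exact integral_congr_ae h2

/-! ### The direct problem -/

/-- `u`, with first and second time derivatives `u'` and `u''`, is a weak solution of
`ρ u_tt + μ u_t + (r u_xx)_xx + (κ u_xxt)_xx = 0` on `(0,ℓ) × (0,T)`, clamped at `x = 0`, with
zero bending moment and shear force `g` at `x = ℓ`, and zero initial displacement and velocity:
`u, u' ∈ L²(0,T;𝒱₁²(0,ℓ))`, `u'' ∈ L²(0,T;L²(0,ℓ))`, and the weak formulation holds at almost
every time. The time derivatives are those of absolutely continuous functions with values in a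
Hilbert space (Bochner integrals), `u` and `u'` being the continuous representatives with values
in `𝒱₁²(0,ℓ)` and in `L²(0,ℓ)`. -/
structure IsWeakSolution (ℓ T : ℝ) (ρ μ r κ g : ℝ → ℝ) (u u' : ℝ → Jet ℓ) (u'' : ℝ → L2 ℓ) :
    Prop where
  memV : ∀ t ∈ Icc 0 T, MemV ℓ (u t)
  memV' : ∀ᵐ t ∂(volume.restrict (Ioo 0 T)), MemV ℓ (u' t)
  memLp : MemLp u 2 (volume.restrict (Ioo 0 T))
  memLp' : MemLp u' 2 (volume.restrict (Ioo 0 T))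
  memLp'' : MemLp u'' 2 (volume.restrict (Ioo 0 T))
  eq_integral : ∀ t ∈ Icc 0 T, u t = u 0 + ∫ s in (0 : ℝ)..t, u' s
  eq_integral' : ∀ t ∈ Icc 0 T, u' t 0 = u' 0 0 + ∫ s in (0 : ℝ)..t, u'' s
  initial : u 0 = 0
  initial' : u' 0 0 = 0
  weak : ∀ᵐ t ∂(volume.restrict (Ioo 0 T)), ∀ v : Jet ℓ, MemV ℓ v →
    (∫ x in (0 : ℝ)..ℓ, ρ x * u'' t x * v 0 x) + (∫ x in (0 : ℝ)..ℓ, μ x * u' t 0 x * v 0 x)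
      + (∫ x in (0 : ℝ)..ℓ, r x * u t 2 x * v 2 x) + (∫ x in (0 : ℝ)..ℓ, κ x * u' t 2 x * v 2 x)
      = g t * tip ℓ v

/-- `y = Φ g`: on `[0,T]`, `y(t) = u(ℓ,t)` for the weak solution `u` with shear force `g`. -/
def IsDeflection (ℓ T : ℝ) (ρ μ r κ g y : ℝ → ℝ) : Prop :=
  ∃ (u u' : ℝ → Jet ℓ) (u'' : ℝ → L2 ℓ), IsWeakSolution ℓ T ρ μ r κ g u u' u'' ∧
    ∀ t ∈ Icc 0 T, y t = tip ℓ (u t)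

/-! ### The inverse problem -/

/-- The admissible shear forces: `g ∈ H¹(0,T)`, `g(0) = 0`, `‖g‖_{H¹(0,T)} ≤ C`. -/
def Admissible (T C : ℝ) (g : ℝ → ℝ) : Prop :=
  MemH1 T g ∧ g 0 = 0 ∧ normH1 T g ≤ C

/-- The regularized Tikhonov functional `½ ‖y - ν‖² + (α/2) ‖g'‖²` (norms of `L²(0,T)`), to be
evaluated at `y = Φ g`. -/
def tikhonov (T α : ℝ) (ν y g : ℝ → ℝ) : ℝ :=
  1 / 2 * (∫ t in (0 : ℝ)..T, (y t - ν t) ^ 2) + α / 2 * ∫ t in (0 : ℝ)..T, deriv g t ^ 2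

/-- `g`, with deflection `y = Φ g`, minimizes the regularized Tikhonov functional for the data `ν`
over the admissible shear forces. -/
def IsMinimizer (ℓ T α C : ℝ) (ρ μ r κ ν g y : ℝ → ℝ) : Prop :=
  Admissible T C g ∧ IsDeflection ℓ T ρ μ r κ g y ∧
    ∀ h z : ℝ → ℝ, Admissible T C h → IsDeflection ℓ T ρ μ r κ h z →
      tikhonov T α ν y g ≤ tikhonov T α ν z h

/-- The lower bound required of the Kelvin–Voigt coefficient. -/
def kappaZero (ℓ T α r₀ : ℝ) : ℝ :=
  Real.sqrt 2 * T ^ 2 * ℓ ^ 6 * Real.exp T * (1 + T) / (9 * r₀ * α)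

/-- The stability constant. -/
def stabilityConst (ℓ T α r₀ : ℝ) : ℝ :=
  9 * r₀ * kappaZero ℓ T α r₀ * T ^ 2 / (ℓ ^ 6 * Real.exp T * (1 + T))

end Beam

end

theorem MeasureTheory.integral_sq_add_mul {X : Type*} [MeasurableSpace X] {m : Measure X}
    {f g : X → ℝ} (hf : MemLp f 2 m) (hg : MemLp g 2 m) (s : ℝ) :
    ∫ x, (f x + s * g x) ^ 2 ∂m
      = ∫ x, f x ^ 2 ∂m + s * (2 * ∫ x, f x * g x ∂m) + s ^ 2 * ∫ x, g x ^ 2 ∂m := by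
  have h1 : Integrable (fun x => f x * g x) m := hf.integrable_mul hg
  calc ∫ x, (f x + s * g x) ^ 2 ∂m
      = ∫ x, (f x ^ 2 + (s * 2) * (f x * g x) + s ^ 2 * g x ^ 2) ∂m := by
        congr 1; ext x; ring
    _ = _ := by
        have h2 : Integrable (fun x => f x ^ 2 + s * 2 * (f x * g x)) m :=
          hf.integrable_sq.add (h1.const_mul _)
        rw [integral_add h2 (hg.integrable_sq.const_mul _),
          integral_add hf.integrable_sq (h1.const_mul _), integral_const_mul, integral_const_mul]
        ring

theorem MeasureTheory.sq_integral_mul_le {X : Type*} [MeasurableSpace X] {m : Measure X}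
    {f g : X → ℝ} (hf : MemLp f 2 m) (hg : MemLp g 2 m) :
    (∫ x, f x * g x ∂m) ^ 2 ≤ (∫ x, f x ^ 2 ∂m) * ∫ x, g x ^ 2 ∂m := by
  have h := discrim_le_zero (a := ∫ x, g x ^ 2 ∂m) (b := 2 * ∫ x, f x * g x ∂m)
    (c := ∫ x, f x ^ 2 ∂m) fun s => by
      have h1 := integral_sq_add_mul hf hg s
      have h2 : 0 ≤ ∫ x, (f x + s * g x) ^ 2 ∂m := integral_nonneg fun x => sq_nonneg _
      nlinarith
  rw [discrim] at h
  nlinarith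

namespace Beam

theorem integral_eq_Ioo {E : Type*} [NormedAddCommGroup E] [NormedSpace ℝ E] {L : ℝ} (hL : 0 ≤ L)
    (f : ℝ → E) : ∫ t in (0 : ℝ)..L, f t = ∫ t in Ioo 0 L, f t := by
  rw [intervalIntegral.integral_of_le hL, integral_Ioc_eq_integral_Ioo]

theorem intervalIntegrable_of_Ioo {E : Type*} [NormedAddCommGroup E] {L t : ℝ} {f : ℝ → E}
    (hf : Integrable f (volume.restrict (Ioo 0 L))) (ht : t ∈ Icc 0 L) :
    IntervalIntegrable f volume 0 t := by
  rw [intervalIntegrable_iff_integrableOn_Ioo_of_le ht.1]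
  exact IntegrableOn.mono_set hf (Ioo_subset_Ioo_right ht.2)

theorem memLp_of_continuousOn {L : ℝ} {f : ℝ → ℝ} (hf : ContinuousOn f (Icc 0 L))
    (p : ENNReal) : MemLp f p (volume.restrict (Ioo 0 L)) := by
  obtain ⟨M, hM⟩ := isCompact_Icc.exists_bound_of_continuousOn hf
  refine MemLp.of_bound ((hf.mono Ioo_subset_Icc_self).aestronglyMeasurable measurableSet_Ioo) M ?_
  exact (ae_restrict_mem measurableSet_Ioo).mono fun x hx => hM x (Ioo_subset_Icc_self hx)

theorem ae_Ioo_of_ae_Icc {L : ℝ} (hL : 0 ≤ L) {P : ℝ → Prop} (h : ∀ᵐ x, x ∈ uIcc 0 L → P x) :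
    ∀ᵐ x ∂(volume.restrict (Ioo 0 L)), P x := by
  rw [uIcc_of_le hL] at h
  filter_upwards [ae_restrict_of_ae h, ae_restrict_mem measurableSet_Ioo] with x hx hx'
  exact hx (Ioo_subset_Icc_self hx')

theorem MemH1.continuousOn {L : ℝ} (hL : 0 ≤ L) {f : ℝ → ℝ} (hf : MemH1 L f) :
    ContinuousOn f (Icc 0 L) := by
  simpa [uIcc_of_le hL] using hf.1.continuousOn

theorem MemH1.memLp {L : ℝ} (hL : 0 ≤ L) {f : ℝ → ℝ} (hf : MemH1 L f) :
    MemLp f 2 (volume.restrict (Ioo 0 L)) :=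
  memLp_of_continuousOn (hf.continuousOn hL) 2

theorem MemH1.deriv_add_smul {L : ℝ} (hL : 0 ≤ L) {f g : ℝ → ℝ} (hf : MemH1 L f)
    (hg : MemH1 L g) (s : ℝ) :
    deriv (fun x => f x + s * g x) =ᵐ[volume.restrict (Ioo 0 L)]
      fun x => deriv f x + s * deriv g x := by
  filter_upwards [ae_Ioo_of_ae_Icc hL hf.1.ae_differentiableAt,
    ae_Ioo_of_ae_Icc hL hg.1.ae_differentiableAt] with x h1 h2
  exact (h1.hasDerivAt.add (h2.hasDerivAt.const_mul s)).deriv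

theorem MemH1.add_smul {L : ℝ} (hL : 0 ≤ L) {f g : ℝ → ℝ} (hf : MemH1 L f)
    (hg : MemH1 L g) (s : ℝ) : MemH1 L (fun x => f x + s * g x) :=
  ⟨hf.1.add (hg.1.const_mul s),
    (hf.2.add (hg.2.const_mul s)).ae_eq (hf.deriv_add_smul hL hg s).symm⟩

theorem MemH1.sq_sub_le {L : ℝ} {f : ℝ → ℝ} (hf : MemH1 L f) {a b : ℝ} (ha : 0 ≤ a)
    (hab : a ≤ b) (hb : b ≤ L) :
    (f b - f a) ^ 2 ≤ (b - a) * ∫ t in (0 : ℝ)..L, deriv f t ^ 2 := by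
  have hsub : Ioo a b ⊆ Ioo 0 L := Ioo_subset_Ioo ha hb
  have hd : MemLp (deriv f) 2 (volume.restrict (Ioo a b)) :=
    hf.2.mono_measure (Measure.restrict_mono hsub le_rfl)
  have hac : AbsolutelyContinuousOnInterval f a b := hf.1.mono <| by
    rw [uIcc_of_le hab, uIcc_of_le (ha.trans (hab.trans hb))]
    exact Icc_subset_Icc ha hb
  rw [← hac.integral_deriv_eq_sub, intervalIntegral.integral_of_le hab,
    integral_Ioc_eq_integral_Ioo, integral_eq_Ioo (ha.trans (hab.trans hb))]
  have h := sq_integral_mul_le hd (memLp_const (1 : ℝ))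
  have h2 : ∫ t in Ioo a b, deriv f t ^ 2 ≤ ∫ t in Ioo 0 L, deriv f t ^ 2 :=
    setIntegral_mono_set hf.2.integrable_sq (ae_of_all _ fun x => sq_nonneg _) hsub.eventuallyLE
  simp only [mul_one, one_pow, integral_const, smul_eq_mul, measureReal_restrict_apply_univ,
    Real.volume_real_Ioo_of_le hab] at h
  calc _ ≤ _ := h
    _ ≤ _ := by rw [mul_comm]; exact mul_le_mul_of_nonneg_left h2 (sub_nonneg.2 hab)

theorem integral_deriv_sq_nonneg {L : ℝ} (hL : 0 ≤ L) (f : ℝ → ℝ) :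
    0 ≤ ∫ t in (0 : ℝ)..L, deriv f t ^ 2 :=
  intervalIntegral.integral_nonneg hL fun _ _ => sq_nonneg _

theorem MemH1.intervalIntegrable_sq {L : ℝ} (hL : 0 ≤ L) {f : ℝ → ℝ} (hf : MemH1 L f) :
    IntervalIntegrable (fun t => f t ^ 2) volume 0 L :=
  intervalIntegrable_of_Ioo (hf.memLp hL).integrable_sq ⟨hL, le_rfl⟩

/-- Poincaré's inequality for functions vanishing at some point of the interval. -/
theorem MemH1.poincare {L : ℝ} (hL : 0 ≤ L) {f : ℝ → ℝ} (hf : MemH1 L f) {a : ℝ}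
    (ha : a ∈ Icc 0 L) (h0 : f a = 0) :
    ∫ t in (0 : ℝ)..L, f t ^ 2 ≤ L ^ 2 * ∫ t in (0 : ℝ)..L, deriv f t ^ 2 := by
  have hD := integral_deriv_sq_nonneg hL f
  set D := ∫ t in (0 : ℝ)..L, deriv f t ^ 2
  have h : ∀ t ∈ Icc 0 L, f t ^ 2 ≤ L * D := by
    intro t ht
    rcases le_total a t with h | h
    · have := hf.sq_sub_le ha.1 h ht.2
      rw [h0, sub_zero] at this
      exact this.trans (mul_le_mul_of_nonneg_right (by linarith [ha.1, ht.2]) hD)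
    · have := hf.sq_sub_le ht.1 h ha.2
      rw [h0, zero_sub, neg_sq] at this
      exact this.trans (mul_le_mul_of_nonneg_right (by linarith [ht.1, ha.2]) hD)
  calc ∫ t in (0 : ℝ)..L, f t ^ 2 ≤ ∫ t in (0 : ℝ)..L, L * D :=
        intervalIntegral.integral_mono_on hL (hf.intervalIntegrable_sq hL) (by simp) h
    _ = _ := by simp; ring

/-- Poincaré's inequality for functions vanishing at the left endpoint. -/
theorem MemH1.poincare_zero {L : ℝ} (hL : 0 ≤ L) {f : ℝ → ℝ} (hf : MemH1 L f) (h0 : f 0 = 0) :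
    ∫ t in (0 : ℝ)..L, f t ^ 2 ≤ L ^ 2 / 2 * ∫ t in (0 : ℝ)..L, deriv f t ^ 2 := by
  set D := ∫ t in (0 : ℝ)..L, deriv f t ^ 2 with hDdef
  calc ∫ t in (0 : ℝ)..L, f t ^ 2 ≤ ∫ t in (0 : ℝ)..L, t * D := by
        refine intervalIntegral.integral_mono_on hL (hf.intervalIntegrable_sq hL)
          (intervalIntegral.intervalIntegrable_id.mul_const D) fun t ht => ?_
        have := hf.sq_sub_le le_rfl ht.1 ht.2
        rwa [h0, sub_zero, sub_zero] at this
    _ = _ := by rw [intervalIntegral.integral_mul_const, integral_id]; ring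

/-- From an energy inequality to a bound of the velocity by the derivative of the force. -/
theorem integral_deriv_sq_le_of_energy {T c κ₀ r₀ : ℝ} (hT : 0 ≤ T) (hc : 0 < c) (hκ₀ : 0 < κ₀)
    (hr₀ : 0 < r₀) {y g : ℝ → ℝ} (hy : MemH1 T y) (hg : MemH1 T g) (hg0 : g 0 = 0)
    (henergy : ∀ t ∈ Icc 0 T, c * κ₀ * (∫ s in (0 : ℝ)..t, deriv y s ^ 2) + c * r₀ / 2 * y t ^ 2
      ≤ ∫ s in (0 : ℝ)..t, g s * deriv y s) :
    ∫ s in (0 : ℝ)..T, deriv y s ^ 2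
      ≤ (1 + T) * Real.exp T / (c ^ 2 * r₀ * κ₀) * ∫ s in (0 : ℝ)..T, deriv g s ^ 2 := by
  have hG := integral_deriv_sq_nonneg hT g
  set G := ∫ s in (0 : ℝ)..T, deriv g s ^ 2 with hGdef
  set b := c * r₀ with hb
  have hb0 : 0 < b := by positivity
  set A := (1 + T) / b * G with hA
  have hyc := hy.continuousOn hT
  have young : ∀ p q : ℝ, p * q ≤ 1 / b * p ^ 2 + b / 4 * q ^ 2 := fun p q => by
    have : 1 / b * p ^ 2 + b / 4 * q ^ 2 - p * q = (p - b / 2 * q) ^ 2 / b := by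
      field_simp; ring
    have h2 : 0 ≤ (p - b / 2 * q) ^ 2 / b := by positivity
    linarith
  have hbound : ∀ t ∈ Icc 0 T, c * κ₀ * (∫ s in (0 : ℝ)..t, deriv y s ^ 2) + b / 4 * y t ^ 2
      ≤ A + b / 4 * ∫ s in (0 : ℝ)..t, y s ^ 2 := by
    intro t ht
    have hsub : uIcc 0 t ⊆ uIcc 0 T := by
      rw [uIcc_of_le ht.1, uIcc_of_le hT]; exact Icc_subset_Icc_right ht.2
    have hparts := (hg.1.mono hsub).integral_mul_deriv_eq_deriv_mul (hy.1.mono hsub)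
    rw [hg0, zero_mul, sub_zero] at hparts
    have h1 := henergy t ht
    have hgt : g t ^ 2 ≤ T * G := by
      have := hg.sq_sub_le le_rfl ht.1 ht.2
      rw [hg0, sub_zero, sub_zero] at this
      exact this.trans (mul_le_mul_of_nonneg_right ht.2 hG)
    have i1 : IntervalIntegrable (fun s => deriv g s ^ 2) volume 0 t :=
      intervalIntegrable_of_Ioo hg.2.integrable_sq ht
    have i2 : IntervalIntegrable (fun s => y s ^ 2) volume 0 t :=
      intervalIntegrable_of_Ioo (hy.memLp hT).integrable_sq ht
    have i3 : IntervalIntegrable (fun s => deriv g s * y s) volume 0 t :=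
      intervalIntegrable_of_Ioo (hg.2.integrable_mul (hy.memLp hT)) ht
    have h2 : -(∫ s in (0 : ℝ)..t, deriv g s * y s)
        ≤ 1 / b * (∫ s in (0 : ℝ)..t, deriv g s ^ 2) + b / 4 * ∫ s in (0 : ℝ)..t, y s ^ 2 := by
      rw [← intervalIntegral.integral_neg, ← intervalIntegral.integral_const_mul,
        ← intervalIntegral.integral_const_mul,
        ← intervalIntegral.integral_add (i1.const_mul _) (i2.const_mul _)]
      refine intervalIntegral.integral_mono_on ht.1 i3.neg
        ((i1.const_mul _).add (i2.const_mul _)) fun s _ => ?_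
      have := young (-(deriv g s)) (y s)
      rw [neg_sq] at this
      linarith
    have h3 : ∫ s in (0 : ℝ)..t, deriv g s ^ 2 ≤ G :=
      intervalIntegral.integral_mono_interval le_rfl ht.1 ht.2 (ae_of_all _ fun _ => sq_nonneg _)
        (intervalIntegrable_of_Ioo hg.2.integrable_sq ⟨hT, le_rfl⟩)
    have h4 : 1 / b * (∫ s in (0 : ℝ)..t, deriv g s ^ 2) ≤ 1 / b * G :=
      mul_le_mul_of_nonneg_left h3 (by positivity)
    have h5 : 1 / b * g t ^ 2 ≤ 1 / b * (T * G) :=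
      mul_le_mul_of_nonneg_left hgt (by positivity)
    have h6 : A = 1 / b * (T * G) + 1 / b * G := by rw [hA]; ring
    linarith [young (g t) (y t)]
  have hint : IntegrableOn (fun s => b / 4 * y s ^ 2) (uIcc 0 T) := by
    rw [uIcc_of_le hT]
    exact ((hyc.pow 2).const_smul (b / 4)).integrableOn_Icc
  have hgron := le_gronwallBound_of_liminf_deriv_right_le
    (f := fun t => ∫ s in (0 : ℝ)..t, b / 4 * y s ^ 2) (f' := fun t => b / 4 * y t ^ 2)
    (δ := 0) (K := 1) (ε := A) (a := 0) (b := T)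
    (by simpa [uIcc_of_le hT] using intervalIntegral.continuousOn_primitive_interval hint)
    (fun t ht r hr => by
      have hd : HasDerivWithinAt (fun t => ∫ s in (0 : ℝ)..t, b / 4 * y s ^ 2)
          (b / 4 * y t ^ 2) (Ioi t) t := by
        have hcw : ContinuousOn (fun s => b / 4 * y s ^ 2) (Icc 0 T) :=
          continuousOn_const.mul (hyc.pow 2)
        refine intervalIntegral.integral_hasDerivWithinAt_right (s := Ici t) (t := Ioi t)
          ?_ ?_ ?_ |>.mono Ioi_subset_Ici_self
        · exact (hcw.mono (Icc_subset_Icc_right ht.2.le)).intervalIntegrable_of_Icc ht.1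
        · exact ⟨Ioo t T, Ioo_mem_nhdsGT ht.2, ((hcw.mono
            ((Ioo_subset_Ioo_left ht.1).trans Ioo_subset_Icc_self)).aestronglyMeasurable
              measurableSet_Ioo)⟩
        · exact (hcw t (Ico_subset_Icc_self ht)).mono_of_mem_nhdsWithin
            (Filter.mem_of_superset (Ioo_mem_nhdsGT ht.2)
              ((Ioo_subset_Ioo_left ht.1).trans Ioo_subset_Icc_self))
      have := (hd.limsup_slope_le' (by simp) hr).frequently
      simpa [slope_def_field, div_eq_inv_mul] using this)
    (by simp)
    (fun t ht => by
      have := hbound t (Ico_subset_Icc_self ht)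
      have h0 : 0 ≤ c * κ₀ * (∫ s in (0 : ℝ)..t, deriv y s ^ 2) :=
        mul_nonneg (by positivity) (integral_deriv_sq_nonneg ht.1 y)
      simp only [one_mul, intervalIntegral.integral_const_mul]
      linarith) T ⟨hT, le_rfl⟩
  rw [gronwallBound_of_K_ne_0 one_ne_zero] at hgron
  simp only [zero_mul, zero_add, div_one, one_mul, sub_zero,
    intervalIntegral.integral_const_mul] at hgron
  have hend := hbound T ⟨hT, le_rfl⟩
  have hyT : 0 ≤ b / 4 * y T ^ 2 := by positivity
  have hfin : c * κ₀ * (∫ s in (0 : ℝ)..T, deriv y s ^ 2) ≤ A * Real.exp T := by linarith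
  have : (1 + T) * Real.exp T / (c ^ 2 * r₀ * κ₀) * G = A * Real.exp T / (c * κ₀) := by
    rw [hA, hb]; field_simp
  rw [this, le_div_iff₀ (by positivity)]
  linarith

end Beam

theorem ContinuousLinearMap.intervalIntegrable_apply_primitive {H : Type*} [NormedAddCommGroup H]
    [NormedSpace ℝ H] (B : H →L[ℝ] H →L[ℝ] ℝ) {f F : ℝ → H} {t : ℝ} (ht : 0 ≤ t)
    (hf : IntervalIntegrable f volume 0 t) (hF : ContinuousOn F (Icc 0 t)) :
    IntervalIntegrable (fun s => B (f s) (F s)) volume 0 t := by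
  obtain ⟨M, hM⟩ := isCompact_Icc.exists_bound_of_continuousOn hF
  rw [intervalIntegrable_iff_integrableOn_Icc_of_le ht] at hf ⊢
  refine Integrable.mono' (hf.norm.const_mul (‖B‖ * M)) ?_ ?_
  · exact B.aestronglyMeasurable_comp₂ hf.aestronglyMeasurable
      (hF.aestronglyMeasurable measurableSet_Icc)
  · filter_upwards [ae_restrict_mem measurableSet_Icc] with s hs
    calc ‖B (f s) (F s)‖ ≤ ‖B‖ * ‖f s‖ * ‖F s‖ := B.le_opNorm₂ _ _
      _ ≤ ‖B‖ * ‖f s‖ * M := by gcongr; exact hM s hs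
      _ = _ := by ring

/-- The energy identity for a symmetric bilinear form along a primitive. -/
theorem ContinuousLinearMap.integral_apply_primitive {H : Type*} [NormedAddCommGroup H]
    [NormedSpace ℝ H] [CompleteSpace H] (B : H →L[ℝ] H →L[ℝ] ℝ) (hB : ∀ a b, B a b = B b a)
    {f F : ℝ → H} {t : ℝ} (ht : 0 ≤ t) (hf : IntervalIntegrable f volume 0 t)
    (hF : ∀ s ∈ Icc 0 t, F s = ∫ σ in (0 : ℝ)..s, f σ) :
    ∫ s in (0 : ℝ)..t, B (f s) (F s) = 1 / 2 * B (F t) (F t) := by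
  set P : ℝ → H := fun s => ∫ σ in (0 : ℝ)..s, f σ with hP
  have hPF : ∀ s ∈ Icc 0 t, F s = P s := hF
  have hPc : ContinuousOn P (Icc 0 t) := by
    have h := (intervalIntegrable_iff_integrableOn_Icc_of_le ht).1 hf
    rw [← uIcc_of_le ht] at h ⊢
    exact intervalIntegral.continuousOn_primitive_interval h
  obtain ⟨M, hM⟩ := isCompact_Icc.exists_bound_of_continuousOn hPc
  have hsub : ∀ a ∈ Icc 0 t, IntervalIntegrable f volume 0 a := fun a ha => hf.mono_set <| by
    rw [uIcc_of_le ha.1, uIcc_of_le ht]; exact Icc_subset_Icc_right ha.2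
  have hdist : ∀ a ∈ Icc 0 t, ∀ b ∈ Icc 0 t, dist (P a) (P b) ≤
      dist (∫ σ in (0 : ℝ)..a, ‖f σ‖) (∫ σ in (0 : ℝ)..b, ‖f σ‖) := by
    intro a ha b hb
    rw [dist_eq_norm, Real.dist_eq, hP]
    simp only
    rw [intervalIntegral.integral_interval_sub_left (hsub a ha) (hsub b hb),
      intervalIntegral.integral_interval_sub_left (hsub a ha).norm (hsub b hb).norm]
    exact intervalIntegral.norm_integral_le_abs_integral_norm
  have hac0 : AbsolutelyContinuousOnInterval (fun a => ∫ σ in (0 : ℝ)..a, ‖f σ‖) 0 t :=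
    hf.norm.absolutelyContinuousOnInterval_intervalIntegral left_mem_uIcc
  have hφ : ∀ a ∈ Icc 0 t, ∀ b ∈ Icc 0 t, dist (B (P a) (P a)) (B (P b) (P b)) ≤
      2 * ‖B‖ * M * dist (∫ σ in (0 : ℝ)..a, ‖f σ‖) (∫ σ in (0 : ℝ)..b, ‖f σ‖) := by
    intro a ha b hb
    have hM0 : 0 ≤ M := (norm_nonneg _).trans (hM a ha)
    have h1 : B (P a) (P a) - B (P b) (P b) = B (P a - P b) (P a + P b) := by
      simp only [map_sub, map_add, sub_apply]
      rw [hB (P b) (P a)]; ring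
    have h2 : ‖P a + P b‖ ≤ 2 * M := (norm_add_le _ _).trans (by linarith [hM a ha, hM b hb])
    rw [Real.dist_eq, h1, ← Real.norm_eq_abs]
    calc _ ≤ ‖B‖ * ‖P a - P b‖ * ‖P a + P b‖ := B.le_opNorm₂ _ _
      _ ≤ ‖B‖ * ‖P a - P b‖ * (2 * M) := by gcongr
      _ = 2 * ‖B‖ * M * ‖P a - P b‖ := by ring
      _ ≤ _ := by
        rw [← dist_eq_norm]
        exact mul_le_mul_of_nonneg_left (hdist a ha b hb) (by positivity)
  have hac : AbsolutelyContinuousOnInterval (fun s => B (P s) (P s)) 0 t := by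
    refine squeeze_zero' (Filter.Eventually.of_forall fun E =>
      Finset.sum_nonneg fun _ _ => dist_nonneg) ?_
      (by simpa using Filter.Tendsto.const_mul (2 * ‖B‖ * M) hac0)
    refine Filter.Eventually.filter_mono inf_le_right (Filter.eventually_principal.2 ?_)
    intro E hE
    rw [Finset.mul_sum]
    refine Finset.sum_le_sum fun i hi => ?_
    have h := hE.1 i hi
    rw [uIcc_of_le ht] at h
    exact hφ _ h.1 _ h.2
  have hint := hac.integral_deriv_eq_sub
  have hP0 : P 0 = 0 := by simp [hP]
  rw [hP0, map_zero, sub_zero] at hint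
  rw [hPF t ⟨ht, le_rfl⟩, ← hint, ← intervalIntegral.integral_const_mul]
  refine intervalIntegral.integral_congr_ae ?_
  filter_upwards [hf.ae_hasDerivAt_integral] with s hs hs'
  rw [uIoc_of_le ht] at hs'
  have hs'' : s ∈ Icc 0 t := Ioc_subset_Icc_self hs'
  have hd : HasDerivAt P (f s) s := hs (by rwa [uIcc_of_le ht]) 0 left_mem_uIcc
  have hd2 : HasDerivAt (fun s => B (P s) (P s)) (B (P s) (f s) + B (f s) (P s)) s :=
    B.hasDerivAt_of_bilinear (fun _ => hd) (fun _ => hd)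
  rw [hd2.deriv, hPF s hs'', hB (P s)]
  ring

namespace Beam

theorem exists_weighted_form {X : Type*} [MeasurableSpace X] {m : Measure X} {c : X → ℝ}
    (hc : MemLp c ⊤ m) :
    ∃ B : Lp ℝ 2 m →L[ℝ] Lp ℝ 2 m →L[ℝ] ℝ, ∀ a b, B a b = ∫ x, c x * a x * b x ∂m := by
  let A : Lp ℝ 2 m →L[ℝ] Lp ℝ 2 m :=
    (ContinuousLinearMap.mul ℝ ℝ).holderL m ⊤ 2 2 (hc.toLp c)
  refine ⟨((ContinuousLinearMap.mul ℝ ℝ).lpPairing m 2 2).comp A, fun a b => ?_⟩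
  rw [ContinuousLinearMap.comp_apply, ContinuousLinearMap.lpPairing_eq_integral]
  refine integral_congr_ae ?_
  have h : A a =ᵐ[m] fun x => hc.toLp c x * a x :=
    (ContinuousLinearMap.mul ℝ ℝ).coeFn_holder (hc.toLp c) a
  filter_upwards [h, hc.coeFn_toLp] with x h1 h2
  rw [h1, h2]
  rfl

theorem memLp_top_of_ae_mem {X : Type*} [MeasurableSpace X] {m : Measure X} {c : X → ℝ}
    {c₀ c₁ : ℝ} (hm : AEStronglyMeasurable c m) (hc : ∀ᵐ x ∂m, c₀ ≤ c x ∧ c x ≤ c₁) :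
    MemLp c ⊤ m := by
  refine memLp_top_of_bound hm (max |c₀| |c₁|) (hc.mono fun x hx => ?_)
  exact abs_le_max_abs_abs hx.1 hx.2

theorem mul_integral_sq_le {X : Type*} [MeasurableSpace X] {m : Measure X} {c : X → ℝ} {c₀ c₁ : ℝ}
    (hm : AEStronglyMeasurable c m) (hc : ∀ᵐ x ∂m, c₀ ≤ c x ∧ c x ≤ c₁) (a : Lp ℝ 2 m) :
    c₀ * ∫ x, a x ^ 2 ∂m ≤ ∫ x, c x * a x * a x ∂m := by
  have ha : MemLp a 2 m := Lp.memLp a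
  rw [← integral_const_mul]
  refine integral_mono_ae (ha.integrable_sq.const_mul c₀) ?_ ?_
  · exact (ha.mul' (r := 2) (memLp_top_of_ae_mem hm hc)).integrable_mul ha
  · filter_upwards [hc] with x hx
    nlinarith [mul_le_mul_of_nonneg_right hx.1 (sq_nonneg (a x))]

theorem exists_tip_clm {ℓ : ℝ} (hℓ : 0 ≤ ℓ) : ∃ τ : Jet ℓ →L[ℝ] ℝ, ∀ v, τ v = tip ℓ v := by
  refine ⟨((ContinuousLinearMap.mul ℝ ℝ).lpPairing (volume.restrict (Ioo 0 ℓ)) 2 2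
    ((memLp_const (1 : ℝ)).toLp _)).comp (PiLp.proj 2 (fun _ : Fin 3 => L2 ℓ) 1), fun v => ?_⟩
  rw [ContinuousLinearMap.comp_apply, ContinuousLinearMap.lpPairing_eq_integral, tip,
    integral_eq_Ioo hℓ]
  refine integral_congr_ae ?_
  filter_upwards [(memLp_const (1 : ℝ)).coeFn_toLp (p := 2) (μ := volume.restrict (Ioo 0 ℓ))]
    with x hx
  rw [hx]
  simp

theorem HasH2Deriv.add_smul {L : ℝ} (hL : 0 ≤ L) {f p g q : ℝ → ℝ} (hf : HasH2Deriv L f p)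
    (hg : HasH2Deriv L g q) (s : ℝ) :
    HasH2Deriv L (fun x => f x + s * g x) (fun x => p x + s * q x) := by
  refine ⟨hf.1.add_smul hL hg.1 s, hf.2.1.add_smul hL hg.2.1 s, ?_⟩
  filter_upwards [hf.1.deriv_add_smul hL hg.1 s, hf.2.2, hg.2.2] with x h1 h2 h3
  rw [h1, h2, h3]

theorem coeFn_add_smul {X : Type*} [MeasurableSpace X] {m : Measure X} (a b : Lp ℝ 2 m) (s : ℝ) :
    (a + s • b : Lp ℝ 2 m) =ᵐ[m] fun x => a x + s * b x := by
  filter_upwards [Lp.coeFn_add a (s • b), Lp.coeFn_smul s b] with x h1 h2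
  rw [h1, Pi.add_apply, h2, Pi.smul_apply, smul_eq_mul]

theorem MemV.add_smul {ℓ : ℝ} (hℓ : 0 ≤ ℓ) {v w : Jet ℓ} (hv : MemV ℓ v) (hw : MemV ℓ w) (s : ℝ) :
    MemV ℓ (v + s • w) := by
  obtain ⟨f, p, hf, hf0, hp0, h0, h1, h2⟩ := hv
  obtain ⟨g, q, hg, hg0, hq0, k0, k1, k2⟩ := hw
  refine ⟨_, _, hf.add_smul hℓ hg s, by simp [hf0, hg0], by simp [hp0, hq0], ?_, ?_, ?_⟩
  · filter_upwards [coeFn_add_smul (v 0) (w 0) s, h0, k0] with x e1 e2 e3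
    rw [← e2, ← e3]; exact e1
  · filter_upwards [coeFn_add_smul (v 1) (w 1) s, h1, k1] with x e1 e2 e3
    rw [← e2, ← e3]; exact e1
  · filter_upwards [coeFn_add_smul (v 2) (w 2) s, h2, k2, hf.2.1.deriv_add_smul hℓ hg.2.1 s]
      with x e1 e2 e3 e4
    rw [e4, ← e2, ← e3]; exact e1

/-- The deflection at the tip is controlled by the curvature. -/
theorem MemV.tip_sq_le {ℓ : ℝ} (hℓ : 0 < ℓ) {v : Jet ℓ} (hv : MemV ℓ v) :
    3 / ℓ ^ 3 * tip ℓ v ^ 2 ≤ ∫ x in Ioo 0 ℓ, v 2 x ^ 2 := by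
  obtain ⟨f, p, hf, hf0, hp0, -, h1, h2⟩ := hv
  have hw : MemLp (fun x : ℝ => x - ℓ) 2 (volume.restrict (Ioo 0 ℓ)) :=
    memLp_of_continuousOn (by fun_prop) 2
  have hac : AbsolutelyContinuousOnInterval (fun x : ℝ => x - ℓ) 0 ℓ :=
    (LipschitzWith.of_dist_le_mul (K := 1) fun x y => by simp).lipschitzOnWith
      |>.absolutelyContinuousOnInterval
  have hparts := hac.integral_mul_deriv_eq_deriv_mul hf.2.1.1
  have htip : tip ℓ v = -∫ x in (0 : ℝ)..ℓ, (x - ℓ) * deriv p x := by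
    rw [hparts]
    simp only [sub_self, zero_mul, hp0, mul_zero, zero_sub, neg_neg, deriv_sub_const,
      deriv_id'', one_mul]
    rw [tip, integral_eq_Ioo hℓ.le, integral_eq_Ioo hℓ.le]
    exact integral_congr_ae h1
  have hcs := sq_integral_mul_le hw hf.2.1.2
  have hpoly : ∫ x in Ioo 0 ℓ, (x - ℓ) ^ 2 = ℓ ^ 3 / 3 := by
    rw [← integral_eq_Ioo hℓ.le, intervalIntegral.integral_comp_sub_right (fun x => x ^ 2) ℓ,
      integral_pow]
    push_cast; ring
  have hv2 : ∫ x in Ioo 0 ℓ, v 2 x ^ 2 = ∫ x in Ioo 0 ℓ, deriv p x ^ 2 :=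
    integral_congr_ae (h2.mono fun x hx => by simp only [hx])
  rw [htip, neg_sq, integral_eq_Ioo hℓ.le, hv2]
  rw [hpoly] at hcs
  calc _ ≤ 3 / ℓ ^ 3 * (ℓ ^ 3 / 3 * ∫ x in Ioo 0 ℓ, deriv p x ^ 2) :=
        mul_le_mul_of_nonneg_left hcs (by positivity)
    _ = _ := by field_simp

theorem integral_mono_of_ae_Ioo {T t : ℝ} {f g : ℝ → ℝ} (ht : t ∈ Icc 0 T)
    (hf : IntervalIntegrable f volume 0 t) (hg : IntervalIntegrable g volume 0 t)
    (h : ∀ᵐ s ∂(volume.restrict (Ioo 0 T)), f s ≤ g s) :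
    ∫ s in (0 : ℝ)..t, f s ≤ ∫ s in (0 : ℝ)..t, g s := by
  rw [integral_eq_Ioo ht.1, integral_eq_Ioo ht.1]
  rw [intervalIntegrable_iff_integrableOn_Ioo_of_le ht.1] at hf hg
  exact integral_mono_ae hf hg
    (ae_mono (Measure.restrict_mono (Ioo_subset_Ioo_right ht.2) le_rfl) h)

theorem memH1_of_eq_integral {T : ℝ} (hT : 0 ≤ T) {y w : ℝ → ℝ}
    (hw : MemLp w 2 (volume.restrict (Ioo 0 T)))
    (hy : ∀ t ∈ Icc 0 T, y t = ∫ s in (0 : ℝ)..t, w s) :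
    MemH1 T y ∧ deriv y =ᵐ[volume.restrict (Ioo 0 T)] w := by
  have hint : IntervalIntegrable w volume 0 T :=
    intervalIntegrable_of_Ioo (hw.integrable one_le_two) ⟨hT, le_rfl⟩
  have hac := hint.absolutelyContinuousOnInterval_intervalIntegral (c := 0) left_mem_uIcc
  have hd : deriv y =ᵐ[volume.restrict (Ioo 0 T)] w := by
    filter_upwards [ae_Ioo_of_ae_Icc hT hint.ae_hasDerivAt_integral,
      ae_restrict_mem measurableSet_Ioo] with t ht ht'
    refine ((ht 0 left_mem_uIcc).congr_of_eventuallyEq ?_).deriv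
    filter_upwards [isOpen_Ioo.mem_nhds ht'] with s hs
    exact hy s (Ioo_subset_Icc_self hs)
  refine ⟨⟨?_, hw.ae_eq hd.symm⟩, hd⟩
  refine Filter.Tendsto.congr' ?_ hac
  refine Filter.Eventually.filter_mono inf_le_right (Filter.eventually_principal.2 ?_)
  intro E hE
  refine Finset.sum_congr rfl fun i hi => ?_
  have h := hE.1 i hi
  rw [uIcc_of_le hT] at h
  rw [hy _ h.1, hy _ h.2]

theorem exists_coefficient_form {ℓ : ℝ} (hℓ : 0 ≤ ℓ) {c : ℝ → ℝ} {c₀ c₁ : ℝ}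
    (hm : AEStronglyMeasurable c (volume.restrict (Ioo 0 ℓ)))
    (hc : ∀ᵐ x ∂(volume.restrict (Ioo 0 ℓ)), c₀ ≤ c x ∧ c x ≤ c₁) :
    ∃ B : L2 ℓ →L[ℝ] L2 ℓ →L[ℝ] ℝ,
      (∀ a b : L2 ℓ, ∫ x in (0 : ℝ)..ℓ, c x * a x * b x = B a b) ∧ (∀ a b, B a b = B b a) ∧
      ∀ a : L2 ℓ, c₀ * (∫ x in Ioo 0 ℓ, a x ^ 2) ≤ B a a := by
  obtain ⟨B, hB⟩ := exists_weighted_form (memLp_top_of_ae_mem hm hc)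
  refine ⟨B, fun a b => ?_, fun a b => ?_, fun a => ?_⟩
  · rw [hB, integral_eq_Ioo hℓ]
  · rw [hB, hB]; congr 1; ext x; ring
  · rw [hB]; exact mul_integral_sq_le hm hc a

theorem ae_mem_of_forall_Icc {L : ℝ} {c : ℝ → ℝ} {c₀ c₁ : ℝ}
    (hc : ∀ x ∈ Icc 0 L, c₀ ≤ c x ∧ c x ≤ c₁) :
    ∀ᵐ x ∂(volume.restrict (Ioo 0 L)), c₀ ≤ c x ∧ c x ≤ c₁ :=
  (ae_restrict_mem measurableSet_Ioo).mono fun x hx => hc x (Ioo_subset_Icc_self hx)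

/-- A superposition principle for the direct problem. -/
theorem IsDeflection.add_smul {ℓ T : ℝ} (hℓ : 0 ≤ ℓ) {ρ μ r κ : ℝ → ℝ}
    {ρ₀ ρ₁ μ₀ μ₁ r₀ r₁ κ₀ κ₁ : ℝ}
    (hρm : AEStronglyMeasurable ρ (volume.restrict (Ioo 0 ℓ)))
    (hμm : AEStronglyMeasurable μ (volume.restrict (Ioo 0 ℓ)))
    (hrm : AEStronglyMeasurable r (volume.restrict (Ioo 0 ℓ)))
    (hκm : AEStronglyMeasurable κ (volume.restrict (Ioo 0 ℓ)))
    (hρ : ∀ᵐ x ∂(volume.restrict (Ioo 0 ℓ)), ρ₀ ≤ ρ x ∧ ρ x ≤ ρ₁)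
    (hμ : ∀ᵐ x ∂(volume.restrict (Ioo 0 ℓ)), μ₀ ≤ μ x ∧ μ x ≤ μ₁)
    (hr : ∀ᵐ x ∂(volume.restrict (Ioo 0 ℓ)), r₀ ≤ r x ∧ r x ≤ r₁)
    (hκ : ∀ᵐ x ∂(volume.restrict (Ioo 0 ℓ)), κ₀ ≤ κ x ∧ κ x ≤ κ₁)
    {g h y z : ℝ → ℝ} (hy : IsDeflection ℓ T ρ μ r κ g y) (hz : IsDeflection ℓ T ρ μ r κ h z)
    (s : ℝ) :
    IsDeflection ℓ T ρ μ r κ (fun t => g t + s * h t) (fun t => y t + s * z t) := by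
  obtain ⟨u, u', u'', hu, hyu⟩ := hy
  obtain ⟨w, w', w'', hw, hzw⟩ := hz
  obtain ⟨τ, hτ⟩ := exists_tip_clm hℓ
  obtain ⟨Bρ, eρ, -⟩ := exists_coefficient_form hℓ hρm hρ
  obtain ⟨Bμ, eμ, -⟩ := exists_coefficient_form hℓ hμm hμ
  obtain ⟨Br, er, -⟩ := exists_coefficient_form hℓ hrm hr
  obtain ⟨Bκ, eκ, -⟩ := exists_coefficient_form hℓ hκm hκ
  refine ⟨fun t => u t + s • w t, fun t => u' t + s • w' t, fun t => u'' t + s • w'' t,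
    ⟨?_, ?_, ?_, ?_, ?_, ?_, ?_, ?_, ?_, ?_⟩, ?_⟩
  · exact fun t ht => (hu.memV t ht).add_smul hℓ (hw.memV t ht) s
  · filter_upwards [hu.memV', hw.memV'] with t h1 h2 using h1.add_smul hℓ h2 s
  · exact hu.memLp.add (hw.memLp.const_smul s)
  · exact hu.memLp'.add (hw.memLp'.const_smul s)
  · exact hu.memLp''.add (hw.memLp''.const_smul s)
  · intro t ht
    have i1 := intervalIntegrable_of_Ioo (hu.memLp'.integrable one_le_two) ht
    have i2 : IntervalIntegrable (fun t => s • w' t) volume 0 t :=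
      (intervalIntegrable_of_Ioo (hw.memLp'.integrable one_le_two) ht).smul s
    rw [intervalIntegral.integral_add i1 i2, intervalIntegral.integral_smul,
      hu.eq_integral t ht, hw.eq_integral t ht]
    module
  · intro t ht
    have i1 := intervalIntegrable_of_Ioo (hu.memLp''.integrable one_le_two) ht
    have i2 : IntervalIntegrable (fun t => s • w'' t) volume 0 t :=
      (intervalIntegrable_of_Ioo (hw.memLp''.integrable one_le_two) ht).smul s
    rw [intervalIntegral.integral_add i1 i2, intervalIntegral.integral_smul]
    simp only [PiLp.add_apply, PiLp.smul_apply]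
    rw [hu.eq_integral' t ht, hw.eq_integral' t ht]
    module
  · simp [hu.initial, hw.initial]
  · simp [hu.initial', hw.initial']
  · filter_upwards [hu.weak, hw.weak] with t h1 h2 v hv
    have k1 := h1 v hv
    have k2 := h2 v hv
    rw [eρ, eμ, er, eκ] at k1 k2 ⊢
    simp only [PiLp.add_apply, PiLp.smul_apply, map_add, map_smul, add_apply,
      smul_apply, smul_eq_mul]
    linear_combination k1 + s * k2
  · intro t ht
    simp only
    rw [hyu t ht, hzw t ht, ← hτ, ← hτ, ← hτ, map_add, map_smul, smul_eq_mul]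

/-- The energy inequality for the deflection at the tip. -/
theorem IsDeflection.energy {ℓ T : ℝ} (hℓ : 0 < ℓ) (hT : 0 ≤ T) {ρ μ r κ : ℝ → ℝ}
    {ρ₀ ρ₁ μ₀ μ₁ r₀ r₁ κ₀ κ₁ : ℝ}
    (hρm : AEStronglyMeasurable ρ (volume.restrict (Ioo 0 ℓ)))
    (hμm : AEStronglyMeasurable μ (volume.restrict (Ioo 0 ℓ)))
    (hrm : AEStronglyMeasurable r (volume.restrict (Ioo 0 ℓ)))
    (hκm : AEStronglyMeasurable κ (volume.restrict (Ioo 0 ℓ)))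
    (hρ₀ : 0 ≤ ρ₀) (hμ₀ : 0 ≤ μ₀) (hr₀ : 0 ≤ r₀) (hκ₀ : 0 ≤ κ₀)
    (hρ : ∀ᵐ x ∂(volume.restrict (Ioo 0 ℓ)), ρ₀ ≤ ρ x ∧ ρ x ≤ ρ₁)
    (hμ : ∀ᵐ x ∂(volume.restrict (Ioo 0 ℓ)), μ₀ ≤ μ x ∧ μ x ≤ μ₁)
    (hr : ∀ᵐ x ∂(volume.restrict (Ioo 0 ℓ)), r₀ ≤ r x ∧ r x ≤ r₁)
    (hκ : ∀ᵐ x ∂(volume.restrict (Ioo 0 ℓ)), κ₀ ≤ κ x ∧ κ x ≤ κ₁)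
    {g y : ℝ → ℝ} (hg : ContinuousOn g (Icc 0 T)) (hy : IsDeflection ℓ T ρ μ r κ g y) :
    MemH1 T y ∧ y 0 = 0 ∧ ∀ t ∈ Icc 0 T,
      3 / ℓ ^ 3 * κ₀ * (∫ s in (0 : ℝ)..t, deriv y s ^ 2) + 3 / ℓ ^ 3 * r₀ / 2 * y t ^ 2
        ≤ ∫ s in (0 : ℝ)..t, g s * deriv y s := by
  obtain ⟨u, u', u'', hu, hyu⟩ := hy
  obtain ⟨τ, hτ⟩ := exists_tip_clm hℓ.le
  obtain ⟨Bρ, eρ, sρ, lρ⟩ := exists_coefficient_form hℓ.le hρm hρ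
  obtain ⟨Bμ, eμ, -, lμ⟩ := exists_coefficient_form hℓ.le hμm hμ
  obtain ⟨Br, er, sr, lr⟩ := exists_coefficient_form hℓ.le hrm hr
  obtain ⟨Bκ, eκ, -, lκ⟩ := exists_coefficient_form hℓ.le hκm hκ
  have hnn : ∀ a : L2 ℓ, 0 ≤ ∫ x in Ioo 0 ℓ, a x ^ 2 := fun a =>
    integral_nonneg fun _ => sq_nonneg _
  have hw : MemLp (fun s => τ (u' s)) 2 (volume.restrict (Ioo 0 T)) :=
    hu.memLp'.continuousLinearMap_comp τ
  have hint' : ∀ t ∈ Icc 0 T, IntervalIntegrable u' volume 0 t := fun t ht =>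
    intervalIntegrable_of_Ioo (hu.memLp'.integrable one_le_two) ht
  have hint'' : ∀ t ∈ Icc 0 T, IntervalIntegrable u'' volume 0 t := fun t ht =>
    intervalIntegrable_of_Ioo (hu.memLp''.integrable one_le_two) ht
  have hy0 : y 0 = 0 := by
    rw [hyu 0 ⟨le_rfl, hT⟩, hu.initial, ← hτ, map_zero]
  obtain ⟨hyH, hyd⟩ := memH1_of_eq_integral hT hw (y := y) fun t ht => by
    rw [hyu t ht, ← hτ, τ.intervalIntegral_comp_comm (hint' t ht), hu.eq_integral t ht,
      hu.initial, zero_add]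
  refine ⟨hyH, hy0, fun t ht => ?_⟩
  let π : Jet ℓ →L[ℝ] L2 ℓ := PiLp.proj 2 (fun _ : Fin 3 => L2 ℓ) 2
  have hint2 : IntervalIntegrable (fun s => u' s 2) volume 0 t :=
    intervalIntegrable_of_Ioo ((hu.memLp'.continuousLinearMap_comp π).integrable one_le_two) ht
  have hsub : ∀ s ∈ Icc 0 t, s ∈ Icc 0 T := fun s hs => ⟨hs.1, hs.2.trans ht.2⟩
  have hF0 : ∀ s ∈ Icc 0 t, u' s 0 = ∫ σ in (0 : ℝ)..s, u'' σ := fun s hs => by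
    rw [hu.eq_integral' s (hsub s hs), hu.initial', zero_add]
  have hF2 : ∀ s ∈ Icc 0 t, u s 2 = ∫ σ in (0 : ℝ)..s, u' σ 2 := fun s hs => by
    have h : π (u s) = ∫ σ in (0 : ℝ)..s, π (u' σ) := by
      rw [π.intervalIntegral_comp_comm (hint' s (hsub s hs)), hu.eq_integral s (hsub s hs),
        hu.initial, zero_add]
    exact h
  have hcont : ∀ {f : ℝ → L2 ℓ} {F : ℝ → L2 ℓ}, IntervalIntegrable f volume 0 t →
      (∀ s ∈ Icc 0 t, F s = ∫ σ in (0 : ℝ)..s, f σ) → ContinuousOn F (Icc 0 t) := by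
    intro f F hf hF
    refine ContinuousOn.congr ?_ hF
    rw [intervalIntegrable_iff_integrableOn_Icc_of_le ht.1] at hf
    rw [← uIcc_of_le ht.1] at hf ⊢
    exact intervalIntegral.continuousOn_primitive_interval hf
  have iρ := Bρ.intervalIntegrable_apply_primitive ht.1 (hint'' t ht) (hcont (hint'' t ht) hF0)
  have ir := Br.intervalIntegrable_apply_primitive ht.1 hint2 (hcont hint2 hF2)
  have idρ := Bρ.integral_apply_primitive sρ ht.1 (hint'' t ht) hF0
  have idr := Br.integral_apply_primitive sr ht.1 hint2 hF2
  have iy : IntervalIntegrable (fun s => deriv y s ^ 2) volume 0 t :=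
    intervalIntegrable_of_Ioo hyH.2.integrable_sq ht
  have ig : IntervalIntegrable (fun s => g s * deriv y s) volume 0 t :=
    intervalIntegrable_of_Ioo ((memLp_of_continuousOn hg 2).integrable_mul hyH.2) ht
  have hmono := integral_mono_of_ae_Ioo ht ((iρ.add ir).add (iy.const_mul (3 / ℓ ^ 3 * κ₀))) ig
    (by
      filter_upwards [hu.weak, hu.memV', hyd] with s h1 h2 h3
      have k := h1 _ h2
      rw [eρ, eμ, er, eκ, ← hτ, ← h3] at k
      have kμ := (mul_nonneg hμ₀ (hnn (u' s 0))).trans (lμ (u' s 0))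
      have kκ := (mul_le_mul_of_nonneg_left (h2.tip_sq_le hℓ) hκ₀).trans (lκ (u' s 2))
      rw [← hτ, ← h3] at kκ
      rw [sr] at k
      linarith)
  rw [intervalIntegral.integral_add (iρ.add ir) (iy.const_mul _),
    intervalIntegral.integral_add iρ ir, intervalIntegral.integral_const_mul, idρ, idr] at hmono
  have jρ := (mul_nonneg hρ₀ (hnn (u' t 0))).trans (lρ (u' t 0))
  have jr := (mul_le_mul_of_nonneg_left ((hu.memV t ht).tip_sq_le hℓ) hr₀).trans (lr (u t 2))
  rw [← hyu t ht] at jr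
  linarith

theorem admissible_iff {T C : ℝ} (hC : 0 ≤ C) {g : ℝ → ℝ} :
    Admissible T C g ↔ MemH1 T g ∧ g 0 = 0 ∧
      (∫ t in (0 : ℝ)..T, g t ^ 2) + (∫ t in (0 : ℝ)..T, deriv g t ^ 2) ≤ C ^ 2 := by
  rw [Admissible, normH1, Real.sqrt_le_left hC]

theorem integral_sq_segment_le {X : Type*} [MeasurableSpace X] {m : Measure X} {f h : X → ℝ}
    (hf : MemLp f 2 m) (hh : MemLp h 2 m) {s : ℝ} (hs : s ∈ Icc (0 : ℝ) 1) :
    ∫ x, (f x + s * (h x - f x)) ^ 2 ∂m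
      ≤ (1 - s) * (∫ x, f x ^ 2 ∂m) + s * ∫ x, h x ^ 2 ∂m := by
  rw [← integral_const_mul, ← integral_const_mul, ← integral_add (hf.integrable_sq.const_mul _)
    (hh.integrable_sq.const_mul _)]
  refine integral_mono (hf.add ((hh.sub hf).const_mul s)).integrable_sq
    ((hf.integrable_sq.const_mul _).add (hh.integrable_sq.const_mul _)) fun x => ?_
  simp only
  nlinarith [mul_nonneg (mul_nonneg hs.1 (sub_nonneg.2 hs.2)) (sq_nonneg (h x - f x))]

theorem MemH1.deriv_segment {T : ℝ} (hT : 0 ≤ T) {g h : ℝ → ℝ} (hg : MemH1 T g) (hh : MemH1 T h)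
    (s : ℝ) : deriv (fun t => g t + s * (h t + (-1) * g t)) =ᵐ[volume.restrict (Ioo 0 T)]
      fun t => deriv g t + s * (deriv h t - deriv g t) := by
  filter_upwards [hg.deriv_add_smul hT (hh.add_smul hT hg (-1)) s,
    hh.deriv_add_smul hT hg (-1)] with t h1 h2
  rw [h1, h2]; ring

theorem Admissible.segment {T C : ℝ} (hT : 0 ≤ T) (hC : 0 ≤ C) {g h : ℝ → ℝ}
    (hg : Admissible T C g) (hh : Admissible T C h) {s : ℝ} (hs : s ∈ Icc (0 : ℝ) 1) :
    Admissible T C (fun t => g t + s * (h t + (-1) * g t)) := by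
  rw [admissible_iff hC] at *
  obtain ⟨hgH, hg0, hgC⟩ := hg
  obtain ⟨hhH, hh0, hhC⟩ := hh
  refine ⟨hgH.add_smul hT (hhH.add_smul hT hgH (-1)) s, by simp [hg0, hh0], ?_⟩
  rw [integral_eq_Ioo hT, integral_eq_Ioo hT] at *
  have h1 := integral_sq_segment_le (hgH.memLp hT) (hhH.memLp hT) hs
  have h2 := integral_sq_segment_le hgH.2 hhH.2 hs
  have e1 : ∫ t in Ioo 0 T, (g t + s * (h t + (-1) * g t)) ^ 2
      = ∫ t in Ioo 0 T, (g t + s * (h t - g t)) ^ 2 := by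
    congr 1; ext t; ring
  have e2 : ∫ t in Ioo 0 T, deriv (fun t => g t + s * (h t + (-1) * g t)) t ^ 2
      = ∫ t in Ioo 0 T, (deriv g t + s * (deriv h t - deriv g t)) ^ 2 :=
    integral_congr_ae ((hgH.deriv_segment hT hhH s).mono fun t ht => by simp only [ht])
  rw [e1, e2]
  have h3 := mul_le_mul_of_nonneg_left hgC (sub_nonneg.2 hs.2)
  have h4 := mul_le_mul_of_nonneg_left hhC hs.1
  linarith

theorem nonneg_of_forall_quadratic_nonneg {a b : ℝ}
    (h : ∀ s ∈ Icc (0 : ℝ) 1, 0 ≤ s * a + s ^ 2 * b) : 0 ≤ a := by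
  have ht : Filter.Tendsto (fun s : ℝ => a + s * b) (nhdsWithin 0 (Ioi 0)) (nhds a) := by
    have : Filter.Tendsto (fun s : ℝ => a + s * b) (nhds 0) (nhds (a + 0 * b)) :=
      (by fun_prop : Continuous fun s : ℝ => a + s * b).tendsto 0
    simpa using this.mono_left nhdsWithin_le_nhds
  refine ge_of_tendsto ht ?_
  filter_upwards [Ioo_mem_nhdsGT (zero_lt_one' ℝ)] with s hs
  have h1 := h s (Ioo_subset_Icc_self hs)
  have h2 : 0 ≤ s * (a + s * b) := by linarith
  exact nonneg_of_mul_nonneg_right h2 hs.1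

/-- The variational inequality satisfied by a minimizer. -/
theorem IsMinimizer.variational {ℓ T α C : ℝ} (hT : 0 ≤ T) (hC : 0 ≤ C)
    {ρ μ r κ ν g y h z : ℝ → ℝ}
    (hsup : ∀ {g h y z : ℝ → ℝ}, IsDeflection ℓ T ρ μ r κ g y → IsDeflection ℓ T ρ μ r κ h z →
      ∀ s : ℝ, IsDeflection ℓ T ρ μ r κ (fun t => g t + s * h t) (fun t => y t + s * z t))
    (hν : MemH1 T ν) (hy : MemH1 T y) (hz : MemH1 T z) (hg : IsMinimizer ℓ T α C ρ μ r κ ν g y)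
    (hh : Admissible T C h) (hhz : IsDeflection ℓ T ρ μ r κ h z) :
    0 ≤ (∫ t in Ioo 0 T, (y t - ν t) * (z t - y t))
      + α * ∫ t in Ioo 0 T, deriv g t * (deriv h t - deriv g t) := by
  obtain ⟨hgA, hgy, hmin⟩ := hg
  refine nonneg_of_forall_quadratic_nonneg (b := 1 / 2 * (∫ t in Ioo 0 T, (z t - y t) ^ 2)
    + α / 2 * ∫ t in Ioo 0 T, (deriv h t - deriv g t) ^ 2) fun s hs => ?_
  have hJ := hmin _ _ (hgA.segment hT hC hh hs) (hsup hgy (hsup hhz hgy (-1)) s)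
  have e1 := integral_sq_add_mul ((hy.memLp hT).sub (hν.memLp hT))
    ((hz.memLp hT).sub (hy.memLp hT)) s
  have e2 := integral_sq_add_mul hgA.1.2 (hh.1.2.sub hgA.1.2) s
  simp only [Pi.sub_apply] at e1 e2
  have k1 : ∫ t in Ioo 0 T, (y t + s * (z t + (-1) * y t) - ν t) ^ 2
      = ∫ t in Ioo 0 T, (y t - ν t + s * (z t - y t)) ^ 2 := by
    congr 1; ext t; ring
  have k2 : ∫ t in Ioo 0 T, deriv (fun t => g t + s * (h t + (-1) * g t)) t ^ 2
      = ∫ t in Ioo 0 T, (deriv g t + s * (deriv h t - deriv g t)) ^ 2 :=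
    integral_congr_ae ((hgA.1.deriv_segment hT hh.1 s).mono fun t ht => by simp only [ht])
  simp only [tikhonov, integral_eq_Ioo hT] at hJ
  rw [k1, k2, e1, e2] at hJ
  linarith

theorem mul_le_of_sq_le_mul {T α D N Y H E Δ X : ℝ} (hT : 0 < T) (hα : 0 < α) (hD : 0 ≤ D)
    (hN : 0 ≤ N) (hY : 0 ≤ Y) (hΔ0 : 0 ≤ Δ) (hX : X ^ 2 ≤ E * Δ)
    (hE : E ≤ T ^ 2 * H) (hΔ : Δ ≤ T ^ 2 / 2 * Y) (hH : H ≤ (√Y + √N) ^ 2) (hopt : α * D ≤ -X)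
    (hYD : √2 * T ^ 2 * Y ≤ α * D) : α * D ≤ √2 * T ^ 2 * N := by
  have hs : √2 ^ 2 = 2 := Real.sq_sqrt (by norm_num)
  have hs0 : 0 < √2 := by positivity
  set s := √2
  obtain ⟨e, he⟩ : ∃ e, e = √Y := ⟨_, rfl⟩
  obtain ⟨b, hb⟩ : ∃ b, b = √N := ⟨_, rfl⟩
  have he0 : 0 ≤ e := he ▸ Real.sqrt_nonneg _
  have hb0 : 0 ≤ b := hb ▸ Real.sqrt_nonneg _
  have hY' : Y = e ^ 2 := by rw [he, Real.sq_sqrt hY]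
  have hN' : N = b ^ 2 := by rw [hb, Real.sq_sqrt hN]
  rw [← he, ← hb] at hH
  subst hY' hN'
  have h1 : (s * X) ^ 2 ≤ (T ^ 2 * (e + b) * e) ^ 2 := by
    have h2 : E * Δ ≤ (T ^ 2 * (e + b) ^ 2) * (T ^ 2 / 2 * e ^ 2) :=
      mul_le_mul (hE.trans (mul_le_mul_of_nonneg_left hH (by positivity))) hΔ hΔ0 (by positivity)
    calc (s * X) ^ 2 = 2 * X ^ 2 := by rw [mul_pow, hs]
      _ ≤ 2 * ((T ^ 2 * (e + b) ^ 2) * (T ^ 2 / 2 * e ^ 2)) := by linarith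
      _ = _ := by ring
  have h3 : -(s * X) ≤ T ^ 2 * (e + b) * e := by
    linarith [(abs_le_of_sq_le_sq' h1 (by positivity)).1]
  have h4 : s * (α * D) ≤ T ^ 2 * (e + b) * e :=
    (mul_le_mul_of_nonneg_left hopt hs0.le).trans (by linarith)
  have h5 : s * (s * T ^ 2 * e ^ 2) ≤ s * (α * D) := mul_le_mul_of_nonneg_left hYD hs0.le
  have h6 : s * (s * T ^ 2 * e ^ 2) = 2 * (T ^ 2 * e ^ 2) := by rw [← hs]; ring
  have h7 : α * D ≤ s * T ^ 2 * (b * e) := by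
    have : s * (α * D) ≤ s * (s * T ^ 2 * (b * e)) := by
      have : s * (s * T ^ 2 * (b * e)) = 2 * (T ^ 2 * (b * e)) := by rw [← hs]; ring
      nlinarith
    exact le_of_mul_le_mul_left this hs0
  rcases (mul_nonneg hα.le hD).eq_or_lt with h0 | h0
  · rw [← h0]; positivity
  have h8 : (α * D) * (α * D) ≤ (α * D) * (s * T ^ 2 * b ^ 2) := by
    calc (α * D) * (α * D) ≤ (s * T ^ 2 * (b * e)) * (s * T ^ 2 * (b * e)) :=
          mul_self_le_mul_self h0.le h7
      _ = (s * T ^ 2 * e ^ 2) * (s * T ^ 2 * b ^ 2) := by ring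
      _ ≤ _ := mul_le_mul_of_nonneg_right hYD (by positivity)
  exact le_of_mul_le_mul_left h8 h0

theorem integral_sq_sub_le {X : Type*} [MeasurableSpace X] {m : Measure X} {f g : X → ℝ}
    (hf : MemLp f 2 m) (hg : MemLp g 2 m) :
    ∫ x, (f x - g x) ^ 2 ∂m ≤ (√(∫ x, f x ^ 2 ∂m) + √(∫ x, g x ^ 2 ∂m)) ^ 2 := by
  have hF : 0 ≤ ∫ x, f x ^ 2 ∂m := integral_nonneg fun _ => sq_nonneg _
  have hG : 0 ≤ ∫ x, g x ^ 2 ∂m := integral_nonneg fun _ => sq_nonneg _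
  have h1 := integral_sq_add_mul hf hg (-1)
  have h2 : -(∫ x, f x * g x ∂m) ≤ √(∫ x, f x ^ 2 ∂m) * √(∫ x, g x ^ 2 ∂m) := by
    rw [← Real.sqrt_mul hF]
    refine Real.le_sqrt_of_sq_le ?_
    rw [neg_sq]
    exact sq_integral_mul_le hf hg
  have h3 : ∫ x, (f x - g x) ^ 2 ∂m = ∫ x, (f x + (-1) * g x) ^ 2 ∂m := by
    congr 1; ext x; ring
  rw [h3, h1, add_sq, Real.sq_sqrt hF, Real.sq_sqrt hG]
  linarith

theorem sqrt_two_mul_energyConst {ℓ T α r₀ : ℝ} (hℓ : 0 < ℓ) (hT : 0 < T) (hα : 0 < α)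
    (hr₀ : 0 < r₀) :
    √2 * T ^ 2 * ((1 + T) * Real.exp T / ((3 / ℓ ^ 3) ^ 2 * r₀ * kappaZero ℓ T α r₀)) = α := by
  have : 0 < √2 := by positivity
  have := Real.exp_pos T
  rw [kappaZero]
  field_simp
  norm_num

theorem stabilityConst_eq {ℓ T α r₀ : ℝ} (hℓ : 0 < ℓ) (hT : 0 < T) (hα : 0 < α)
    (hr₀ : 0 < r₀) : stabilityConst ℓ T α r₀ = T ^ 2 * (√2 * T ^ 2 / α) := by
  have := Real.exp_pos T
  rw [stabilityConst, kappaZero]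
  field_simp

theorem kappaZero_pos {ℓ T α r₀ : ℝ} (hℓ : 0 < ℓ) (hT : 0 < T) (hα : 0 < α) (hr₀ : 0 < r₀) :
    0 < kappaZero ℓ T α r₀ := by
  rw [kappaZero]; positivity

end Beam

theorem theorem5p2
    (ℓ T α C : ℝ) (hℓ : 0 < ℓ) (hT : 0 < T) (hα : 0 < α) (hC : 0 < C)
    (ρ μ r κ : ℝ → ℝ) (ρ₀ ρ₁ μ₀ μ₁ r₀ r₁ κ₁ : ℝ)
    -- the basic assumptions on the coefficients
    (hρm : AEStronglyMeasurable ρ (volume.restrict (Ioo 0 ℓ)))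
    (hμm : AEStronglyMeasurable μ (volume.restrict (Ioo 0 ℓ)))
    (hr2 : Beam.MemH2 ℓ r) (hκ2 : Beam.MemH2 ℓ κ)
    (hρ₀ : 0 < ρ₀) (hρ : ∀ᵐ x ∂(volume.restrict (Ioo 0 ℓ)), ρ₀ ≤ ρ x ∧ ρ x ≤ ρ₁)
    (hμ₀ : 0 ≤ μ₀) (hμ : ∀ᵐ x ∂(volume.restrict (Ioo 0 ℓ)), μ₀ ≤ μ x ∧ μ x ≤ μ₁)
    (hr₀ : 0 < r₀) (hr : ∀ x ∈ Icc 0 ℓ, r₀ ≤ r x ∧ r x ≤ r₁)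
    -- the lower bound on the Kelvin–Voigt coefficient
    (hκ : ∀ x ∈ Icc 0 ℓ, Beam.kappaZero ℓ T α r₀ ≤ κ x ∧ κ x ≤ κ₁)
    -- the data, and the minimizers together with their deflections
    (ν ν' : ℝ → ℝ) (hν : Beam.MemH1 T ν) (hν' : Beam.MemH1 T ν')
    (g y g' y' : ℝ → ℝ)
    (hg : Beam.IsMinimizer ℓ T α C ρ μ r κ ν g y)
    (hg' : Beam.IsMinimizer ℓ T α C ρ μ r κ ν' g' y')
    -- consistency of the data: the two residuals agree at some instant
    (hcons : ∃ t₀ ∈ Icc 0 T, y t₀ - ν t₀ = y' t₀ - ν' t₀) :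
    ∫ t in (0 : ℝ)..T, (g' t - g t) ^ 2 ≤
      Beam.stabilityConst ℓ T α r₀ * ∫ t in (0 : ℝ)..T, (deriv ν' t - deriv ν t) ^ 2 := by
  obtain ⟨_, hrH, -⟩ := hr2
  obtain ⟨_, hκH, -⟩ := hκ2
  obtain ⟨t₀, ht₀, hres⟩ := hcons
  have hT' := hT.le
  have hrm := (hrH.memLp hℓ.le).aestronglyMeasurable
  have hκm := (hκH.memLp hℓ.le).aestronglyMeasurable
  have hr' := Beam.ae_mem_of_forall_Icc hr
  have hκ' := Beam.ae_mem_of_forall_Icc hκ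
  have hκ₀ := Beam.kappaZero_pos hℓ hT hα hr₀
  have hsup : ∀ {g h y z : ℝ → ℝ}, Beam.IsDeflection ℓ T ρ μ r κ g y →
      Beam.IsDeflection ℓ T ρ μ r κ h z → ∀ s : ℝ,
      Beam.IsDeflection ℓ T ρ μ r κ (fun t => g t + s * h t) (fun t => y t + s * z t) :=
    fun h1 h2 s => h1.add_smul hℓ.le hρm hμm hrm hκm hρ hμ hr' hκ' h2 s
  have hen : ∀ {g y : ℝ → ℝ}, ContinuousOn g (Icc 0 T) → Beam.IsDeflection ℓ T ρ μ r κ g y → _ :=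
    fun hg hy => Beam.IsDeflection.energy hℓ hT' hρm hμm hrm hκm hρ₀.le hμ₀ hr₀.le hκ₀.le
      hρ hμ hr' hκ' hg hy
  have hgH := hg.1.1
  have hgH' := hg'.1.1
  have hyH := (hen (hgH.continuousOn hT') hg.2.1).1
  have hyH' := (hen (hgH'.continuousOn hT') hg'.2.1).1
  have hv := hg.variational hT' hC.le hsup hν hyH hyH' hg'.1 hg'.2.1
  have hv' := hg'.variational hT' hC.le hsup hν' hyH' hyH hg.1 hg.2.1
  set d : ℝ → ℝ := fun t => g' t + (-1) * g t with hd
  set δ : ℝ → ℝ := fun t => y' t + (-1) * y t with hδ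
  set n : ℝ → ℝ := fun t => ν' t + (-1) * ν t with hn
  set η : ℝ → ℝ := fun t => δ t + (-1) * n t with hη
  have hdH : Beam.MemH1 T d := hgH'.add_smul hT' hgH (-1)
  have hnH : Beam.MemH1 T n := hν'.add_smul hT' hν (-1)
  obtain ⟨hδH, hδ0, hδE⟩ := hen (hdH.continuousOn hT') (hsup hg'.2.1 hg.2.1 (-1))
  have hηH : Beam.MemH1 T η := hδH.add_smul hT' hnH (-1)
  have hd0 : d 0 = 0 := by simp [hd, hg.1.2.1, hg'.1.2.1]
  have hη0 : η t₀ = 0 := by simp only [hη, hδ, hn]; linarith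
  have hYD := Beam.integral_deriv_sq_le_of_energy hT' (by positivity) hκ₀ hr₀ hδH hdH hd0 hδE
  have hopt : α * (∫ t in Ioo 0 T, deriv d t ^ 2) ≤ -∫ t in Ioo 0 T, η t * δ t := by
    have i1 : Integrable (fun t => (y t - ν t) * (y' t - y t)) (volume.restrict (Ioo 0 T)) :=
      ((hyH.memLp hT').sub (hν.memLp hT')).integrable_mul ((hyH'.memLp hT').sub (hyH.memLp hT'))
    have i2 : Integrable (fun t => (y' t - ν' t) * (y t - y' t)) (volume.restrict (Ioo 0 T)) :=
      ((hyH'.memLp hT').sub (hν'.memLp hT')).integrable_mul ((hyH.memLp hT').sub (hyH'.memLp hT'))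
    have i3 : Integrable (fun t => deriv g t * (deriv g' t - deriv g t))
        (volume.restrict (Ioo 0 T)) := hgH.2.integrable_mul (hgH'.2.sub hgH.2)
    have i4 : Integrable (fun t => deriv g' t * (deriv g t - deriv g' t))
        (volume.restrict (Ioo 0 T)) := hgH'.2.integrable_mul (hgH.2.sub hgH'.2)
    have e1 : -(∫ t in Ioo 0 T, η t * δ t) = (∫ t in Ioo 0 T, (y t - ν t) * (y' t - y t))
        + ∫ t in Ioo 0 T, (y' t - ν' t) * (y t - y' t) := by
      rw [← integral_add i1 i2, ← integral_neg]
      congr 1; ext t; simp only [hη, hδ, hn]; ring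
    have e2 : -(∫ t in Ioo 0 T, deriv d t ^ 2)
        = (∫ t in Ioo 0 T, deriv g t * (deriv g' t - deriv g t))
        + ∫ t in Ioo 0 T, deriv g' t * (deriv g t - deriv g' t) := by
      rw [← integral_add i3 i4, ← integral_neg]
      refine integral_congr_ae ((hgH'.deriv_add_smul hT' hgH (-1)).mono fun t ht => ?_)
      simp only [hd, ht]; ring
    have e3 := congrArg (α * ·) e2
    simp only [mul_add] at e3
    linarith
  have hX := sq_integral_mul_le (hηH.memLp hT') (hδH.memLp hT')
  have hE := hηH.poincare hT' ht₀ hη0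
  have hΔ := hδH.poincare_zero hT' hδ0
  have hH := Beam.integral_sq_sub_le hδH.2 hnH.2
  have hηd : ∫ t in Ioo 0 T, deriv η t ^ 2 = ∫ t in Ioo 0 T, (deriv δ t - deriv n t) ^ 2 :=
    integral_congr_ae ((hδH.deriv_add_smul hT' hnH (-1)).mono fun t ht => by
      have h : deriv η t = deriv δ t + (-1) * deriv n t := ht
      simp only [h]; ring)
  have hnd : ∫ t in Ioo 0 T, deriv n t ^ 2 = ∫ t in Ioo 0 T, (deriv ν' t - deriv ν t) ^ 2 :=
    integral_congr_ae ((hν'.deriv_add_smul hT' hν (-1)).mono fun t ht => by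
      simp only [hn, ht]; ring)
  have hdP := hdH.poincare hT' ⟨le_rfl, hT'⟩ hd0
  have hdd : ∫ t in (0 : ℝ)..T, (g' t - g t) ^ 2 = ∫ t in (0 : ℝ)..T, d t ^ 2 := by
    congr 1; ext t; simp only [hd]; ring
  rw [← hηd] at hH
  rw [hdd, Beam.stabilityConst_eq hℓ hT hα hr₀]
  simp only [Beam.integral_eq_Ioo hT'] at *
  rw [← hnd]
  have hnn : ∀ f : ℝ → ℝ, 0 ≤ ∫ t in Ioo 0 T, f t ^ 2 := fun f =>
    integral_nonneg fun _ => sq_nonneg _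
  have hfin := Beam.mul_le_of_sq_le_mul hT hα (hnn (deriv d)) (hnn (deriv n)) (hnn (deriv δ))
    (hnn δ) hX hE hΔ hH hopt (by
      have := mul_le_mul_of_nonneg_left hYD (by positivity : 0 ≤ √2 * T ^ 2)
      rwa [← mul_assoc, Beam.sqrt_two_mul_energyConst hℓ hT hα hr₀] at this)
  refine hdP.trans ?_
  rw [mul_assoc]
  refine mul_le_mul_of_nonneg_left ?_ (by positivity)
  rw [div_mul_eq_mul_div, le_div_iff₀ hα]
  linarith
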